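/- For $S\subseteq\omega$ let $\rho_n(S)=|S\cap\{0,\dots,n-1\}|/n$; $S$ has density $1$ if $\lim_n\rho_n(S)=1$. A dense description of a total function $g:\omega\to\omega$ is a partial function $d:\omega\to\omega$ such that $\{n : d(n)\downarrow=g(n)\}$ has density $1$. The function $g$ is densely computable (relative to $X\in 2^\omega$) if it has a dense description that is partial computable (relative to $X$). Let $\mu$ be Lebesgue (fair coin) measure on $2^\omega$. $X\in 2^\omega$ is weakly $4$-random relative to $f$ if $X$ belongs to every $\Sigma^{0,f}_4$ class $\mathcal C\subseteq 2^\omega$ with $\mu(\mathcal C)=1$. An enumeration operator is a c.e. set $W$ of pairs $(F,k)$ with $F\subset\omega$ finite and $k\in\omega$, and $W^Y=\{k : (\exists (F,k)\in W)\ F\subseteq Y\}$. For $f,g:\omega\to\omega$, $f$ is uniformly densely reducible to $g$ if there is one enumeration operator $W$ such that for every dense description $d$ of $g$, $W^{\mathrm{graph}(d)}$ is the graph of a dense description of $f$; and $f$ is nonuniformly densely reducible to $g$ if for every dense description $d$ of $g$ there are an enumeration operator $W$ and a dense description $e$ of $f$ with $W^{\mathrm{graph}(d)}=\mathrm{graph}(e)$.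 Sets are identified with their characteristic functions. For either reducibility $\le$, the upper cone of $A\in 2^\omega$ is $\{X\in 2^\omega : A\le X\}$; it is nontrivial if it is not all of $2^\omega$, i.e. if the degree of $A$ is not the least degree of sets. **Theorem.** (1) If $f:\omega\to\omega$ is not densely computable, then $$\mu(\{X\in 2^\omega : f \text{ is densely computable relative to } X\})=0,$$ and no element of this class is weakly $4$-random relative to $f$. (2) Every nontrivial upper cone in the uniform dense degrees of sets, and every nontrivial upper cone in the nonuniform dense degrees of sets, has $\mu$-measure $0$. -/

import Mathlib

open Filter Topology MeasureTheory

/-! ### Asymptotic density and dense descriptions -/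

/-- `ρ_n(S) = |S ∩ {0, …, n-1}| / n`, the density of `S` below `n`. -/
noncomputable def densityBelow (S : Set ℕ) (n : ℕ) : ℝ :=
  ((S ∩ Set.Iio n).ncard : ℝ) / (n : ℝ)

/-- `S` has asymptotic density `r`. -/
def HasDensity (S : Set ℕ) (r : ℝ) : Prop :=
  Tendsto (densityBelow S) atTop (𝓝 r)

/-- The partial function `d` is a dense description of the total function `g`:
it converges to the correct value on a set of density `1`. -/
def IsDenseDescription (d : ℕ →. ℕ) (g : ℕ → ℕ) : Prop :=
  HasDensity {n | g n ∈ d n} 1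

/-! ### Cantor space

Elements of `2^ω` are represented as functions `ℕ → Bool`, and are identified with subsets
of `ω` through characteristic functions. -/

/-- The `{0,1}`-valued characteristic function of an element of Cantor space. -/
def charFn (X : ℕ → Bool) : ℕ → ℕ := fun n => (X n).toNat

/-- Lebesgue (fair coin) measure on Cantor space. -/
noncomputable def cantorMeasure : Measure (ℕ → Bool) :=
  Measure.infinitePi fun _ : ℕ => (PMF.uniformOfFintype Bool).toMeasure

/-- The initial segment of `X` of length `k`. -/
def initSeg (X : ℕ → Bool) (k : ℕ) : List Bool := (List.range k).map X

/-! ### Dense computability -/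

/-- `g` is densely computable: it has a partial computable dense description. -/
def DenselyComputable (g : ℕ → ℕ) : Prop :=
  ∃ d : ℕ →. ℕ, Nat.Partrec d ∧ IsDenseDescription d g

/-- `g` is densely computable relative to the oracle `X`: it has a dense description that is
partial computable relative to `X`. -/
def DenselyComputableIn (X : ℕ → Bool) (g : ℕ → ℕ) : Prop :=
  ∃ d : ℕ →. ℕ, Nat.RecursiveIn {(charFn X : ℕ →. ℕ)} d ∧ IsDenseDescription d g

/-! ### The arithmetical hierarchy of classes relative to a function, and weak randomness -/

/-- `C` is a uniform sequence of `Σ^{0,f}_n` classes in Cantor space.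
At level `0` it is a uniformly `f`-computable sequence of clopen classes (whether `X ∈ C i` is
decided, computably in `f`, from an initial segment of `X` whose length is computed in `f`
from `i`). At level `n + 1`, `C i` is the union over `k` of the complements of the members
`D ⟨i, k⟩` of a uniform sequence at level `n`. Unfolding, the members at level `n ≥ 1` are the
classes `{X | ∃ k₁ ∀ k₂ … Q kₙ, R(X, k₁, …, kₙ)}` with `R` decided computably in `f` from a
computable initial segment of `X`; at level `1` these are the effectively (in `f`)
open classes. -/
def IsUniformSigma (f : ℕ → ℕ) : ℕ → (ℕ → Set (ℕ → Bool)) → Prop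
  | 0, C => ∃ (m : ℕ → ℕ) (R : ℕ × List Bool → Bool),
      ComputableIn {(f : ℕ →. ℕ)} m ∧ ComputableIn {(f : ℕ →. ℕ)} R ∧
        ∀ i, C i = {X | R (i, initSeg X (m i)) = true}
  | n + 1, C => ∃ D : ℕ → Set (ℕ → Bool), IsUniformSigma f n D ∧
      ∀ i, C i = ⋃ k, (D (Nat.pair i k))ᶜ

/-- `C` is a `Σ^{0,f}_n` class. -/
def IsSigmaClass (f : ℕ → ℕ) (n : ℕ) (C : Set (ℕ → Bool)) : Prop :=
  ∃ D : ℕ → Set (ℕ → Bool), IsUniformSigma f n D ∧ C = D 0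

/-- `X` is weakly `n`-random (Kurtz `n`-random) relative to `f`: it belongs to every
`Σ^{0,f}_n` class of measure `1`. -/
def WeaklyRandom (n : ℕ) (f : ℕ → ℕ) (X : ℕ → Bool) : Prop :=
  ∀ C : Set (ℕ → Bool), IsSigmaClass f n C → cantorMeasure C = 1 → X ∈ C

/-! ### Enumeration operators and dense reducibilities -/

/-- An enumeration operator is a c.e. collection of pairs `(F, k)` with `F` a finite set, which
is presented here as a list of its elements. -/
def IsEnumOperator (W : Set (List ℕ × ℕ)) : Prop := REPred fun p => p ∈ W

/-- `W^Y = {k | ∃ (F, k) ∈ W, F ⊆ Y}`. -/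
def enumApply (W : Set (List ℕ × ℕ)) (Y : Set ℕ) : Set ℕ :=
  {k | ∃ F : List ℕ, (F, k) ∈ W ∧ ∀ x ∈ F, x ∈ Y}

/-- The (coded) graph of a partial function. -/
def graphOf (d : ℕ →. ℕ) : Set ℕ := {p | p.unpair.2 ∈ d p.unpair.1}

/-- The partial function `e` is enumeration reducible to the partial function `d`. -/
def EnumReducible (e d : ℕ →. ℕ) : Prop :=
  ∃ W, IsEnumOperator W ∧ enumApply W (graphOf d) = graphOf e

/-- `f` is nonuniformly densely reducible to `g`. -/
def NonuniformDenseReducible (f g : ℕ → ℕ) : Prop :=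
  ∀ d, IsDenseDescription d g → ∃ e, IsDenseDescription e f ∧ EnumReducible e d

/-- `f` is uniformly densely reducible to `g`. -/
def UniformDenseReducible (f g : ℕ → ℕ) : Prop :=
  ∃ W, IsEnumOperator W ∧ ∀ d, IsDenseDescription d g →
    ∃ e, IsDenseDescription e f ∧ enumApply W (graphOf d) = graphOf e

/-- For a reducibility `r`, the class of all sets whose `r`-degree lies above that of `A`. -/
def upperCone (r : (ℕ → ℕ) → (ℕ → ℕ) → Prop) (A : ℕ → Bool) : Set (ℕ → Bool) :=
  {X | r (charFn A) (charFn X)}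

/-- The upper cone of `A` is nontrivial: the `r`-degree of `A` is not the least `r`-degree of
sets, i.e. some set is not above `A`. -/
def NontrivialCone (r : (ℕ → ℕ) → (ℕ → ℕ) → Prop) (A : ℕ → Bool) : Prop :=
  ∃ B : ℕ → Bool, ¬ r (charFn A) (charFn B)

/-! The argument is a majority vote in the style of Sacks's theorem on null cones, adapted to
density. A computation from `X` is presented by a primitive recursive monotone map on finite strings
(`IsFunctional`). Relative partial recursiveness yields such a map
(`exists_functional_of_recursiveIn`), and so does enumeration reducibility to the total function
`charFn X` (`exists_functional_of_enumReducible`). There are only countably many of these maps, so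
it suffices to treat one functional `F` at a time.

Suppose the oracles on which `F` is right on a set of density 1 have positive measure. Some clopen
class `K` is more than half filled by them (`exists_clopen_half_lt`). Restrict `F` to `K` and,
without an oracle, search for a value at `n` output by more than half of `K`; at most one value
qualifies (`exists_partrec_majority`). Averaging the success densities over the good oracles, by
dominated convergence, shows that the correct value wins for a set of `n` of density 1
(`hasDensity_majority`). Hence `f` is densely computable (`denselyComputable_of_measure_ne_zero`).

For weak randomness, failure of density 1 has the form ∃e ∀N ∃n≥N ∀s over an `f`-decidable matrix,
so the complement of each null success class is a `Σ⁰₄` class of measure 1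
(`isSigmaClass_not_hasDensity`). For cones, a densely computable set lies below every set, so the
base of a nontrivial cone is not densely computable, and the cone sits inside a null class. -/

/-! ### Continuous functionals presented by monotone approximations -/

/-- `F` is a primitive recursive approximation to a Turing functional: `F (τ, n) = some v` says
that the oracle information `τ` suffices to output `v` at `n`, and this persists when `τ` is
extended. -/
structure IsFunctional (F : List Bool × ℕ → Option ℕ) : Prop where
  primrec : Primrec F
  mono : ∀ {τ τ' : List Bool}, τ <+: τ' → ∀ {n v}, F (τ, n) = some v → F (τ', n) = some v

/-- The functional `F` with oracle `X` computes the partial function `d`. -/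
def FunctionalComputes (F : List Bool × ℕ → Option ℕ) (X : ℕ → Bool) (d : ℕ →. ℕ) : Prop :=
  ∀ n v, v ∈ d n ↔ ∃ k, F (initSeg X k, n) = some v

@[simp]
theorem length_initSeg (X : ℕ → Bool) (k : ℕ) : (initSeg X k).length = k := by simp [initSeg]

theorem take_initSeg (X : ℕ → Bool) {j k : ℕ} (h : j ≤ k) :
    (initSeg X k).take j = initSeg X j := by
  simp [initSeg, ← List.map_take, List.take_range, h]

theorem initSeg_prefix (X : ℕ → Bool) {j k : ℕ} (h : j ≤ k) : initSeg X j <+: initSeg X k := by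
  rw [← take_initSeg X h]; exact List.take_prefix _ _

theorem getElem?_initSeg (X : ℕ → Bool) (k i : ℕ) (b : Bool) :
    (initSeg X k)[i]? = some b ↔ i < k ∧ X i = b := by
  simp [initSeg, List.getElem?_eq_some_iff]

theorem List.IsPrefix.getElem?_eq_some {α : Type*} {l l' : List α} (h : l <+: l') {i : ℕ} {a : α}
    (ha : l[i]? = some a) : l'[i]? = some a := by
  obtain ⟨t, rfl⟩ := h
  rw [List.getElem?_append_left (List.getElem?_eq_some_iff.1 ha).1, ha]

namespace IsFunctional

variable {F G : List Bool × ℕ → Option ℕ}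

theorem mono_initSeg (hF : IsFunctional F) {X : ℕ → Bool} {j k : ℕ} (h : j ≤ k) {n v : ℕ}
    (hv : F (initSeg X j, n) = some v) : F (initSeg X k, n) = some v :=
  hF.mono (initSeg_prefix X h) hv

theorem of_primrec {g : ℕ → ℕ} (hg : Primrec g) : IsFunctional fun p => some (g p.2) :=
  ⟨Primrec.option_some.comp (hg.comp Primrec.snd), fun _ _ _ h => h⟩

theorem oracle : IsFunctional fun p => p.1[p.2]?.map Bool.toNat := by
  refine ⟨Primrec.option_map₁ (Primrec.dom_bool _) |>.comp
    (Primrec.list_getElem?.comp Primrec.fst Primrec.snd), fun h n v hv => ?_⟩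
  simp only [Option.map_eq_some_iff] at hv ⊢
  obtain ⟨b, hb, rfl⟩ := hv
  exact ⟨b, h.getElem?_eq_some hb, rfl⟩

theorem pair (hF : IsFunctional F) (hG : IsFunctional G) :
    IsFunctional fun p => (F p).bind fun a => (G p).map fun b => Nat.pair a b := by
  refine ⟨Primrec.option_bind hF.primrec (Primrec.option_map (hG.primrec.comp Primrec.fst)
    (Primrec₂.natPair.comp (Primrec.snd.comp Primrec.fst) Primrec.snd).to₂).to₂, fun h n v hv => ?_⟩
  simp only [Option.bind_eq_some_iff, Option.map_eq_some_iff] at hv ⊢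
  obtain ⟨a, ha, b, hb, rfl⟩ := hv
  exact ⟨a, hF.mono h ha, b, hG.mono h hb, rfl⟩

theorem comp (hF : IsFunctional F) (hG : IsFunctional G) :
    IsFunctional fun p => (G p).bind fun b => F (p.1, b) := by
  refine ⟨Primrec.option_bind hG.primrec (hF.primrec.comp
    (Primrec.pair (Primrec.fst.comp Primrec.fst) Primrec.snd)).to₂, fun h n v hv => ?_⟩
  simp only [Option.bind_eq_some_iff] at hv ⊢
  obtain ⟨b, hb, hv⟩ := hv
  exact ⟨b, hG.mono h hb, hF.mono h hv⟩

end IsFunctional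

/-- Primitive recursion on functionals, with parameter `a` and `m` steps. -/
def functionalPrec (F G : List Bool × ℕ → Option ℕ) (τ : List Bool) (a m : ℕ) : Option ℕ :=
  m.rec (F (τ, a)) fun y IH => IH.bind fun i => G (τ, Nat.pair a (Nat.pair y i))

theorem functionalPrec_mono {F G : List Bool × ℕ → Option ℕ} (hF : IsFunctional F)
    (hG : IsFunctional G) {τ τ' : List Bool} (h : τ <+: τ') (a m : ℕ) {v : ℕ}
    (hv : functionalPrec F G τ a m = some v) : functionalPrec F G τ' a m = some v := by
  induction m generalizing v with
  | zero => exact hF.mono h hv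
  | succ m ih =>
    simp only [functionalPrec, Option.bind_eq_some_iff] at hv ⊢
    obtain ⟨i, hi, hv⟩ := hv
    exact ⟨i, ih hi, hG.mono h hv⟩

theorem IsFunctional.prec {F G : List Bool × ℕ → Option ℕ} (hF : IsFunctional F)
    (hG : IsFunctional G) :
    IsFunctional fun p => functionalPrec F G p.1 p.2.unpair.1 p.2.unpair.2 := by
  refine ⟨?_, fun h n v hv => functionalPrec_mono hF hG h _ _ hv⟩
  have hu : Primrec fun p : List Bool × ℕ => p.2.unpair := Primrec.unpair.comp Primrec.snd
  have hu1 := Primrec.fst.comp hu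
  refine Primrec.nat_rec' (h := fun p q => q.2.bind fun i =>
    G (p.1, Nat.pair p.2.unpair.1 (Nat.pair q.1 i))) (Primrec.snd.comp hu)
    (hF.primrec.comp (Primrec.pair Primrec.fst hu1)) ?_
  refine Primrec.option_bind (Primrec.snd.comp Primrec.snd) (hG.primrec.comp (Primrec.pair
    (Primrec.fst.comp (Primrec.fst.comp Primrec.fst)) (Primrec₂.natPair.comp
      (hu1.comp (Primrec.fst.comp Primrec.fst)) (Primrec₂.natPair.comp
        (Primrec.fst.comp (Primrec.snd.comp Primrec.fst)) Primrec.snd)))).to₂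

/-- Unbounded search on functionals. -/
def functionalRfind (F : List Bool × ℕ → Option ℕ) (p : List Bool × ℕ) : Option ℕ :=
  let m := (List.range p.1.length).findIdx fun m => decide ((F (p.1, Nat.pair p.2 m)).getD 0 = 0)
  if F (p.1, Nat.pair p.2 m) = some 0 then some m else none

/-- Bounding the search by the length of `τ` keeps it primitive recursive. The default 0 makes an
undefined value halt the search rather than be skipped, and the final test then rejects it; this is
what makes the search monotone in `τ`. The bound is `≤` because `findIdx` returns the length when
nothing is found, and that index is tested too. -/
theorem functionalRfind_eq_some {F : List Bool × ℕ → Option ℕ} {τ : List Bool} {a n : ℕ} :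
    functionalRfind F (τ, a) = some n ↔ n ≤ τ.length ∧ F (τ, Nat.pair a n) = some 0 ∧
      ∀ m < n, ∃ c, c ≠ 0 ∧ F (τ, Nat.pair a m) = some c := by
  have key : ∀ m, (F (τ, Nat.pair a m)).getD 0 ≠ 0 ↔
      ∃ c, c ≠ 0 ∧ F (τ, Nat.pair a m) = some c := by
    intro m
    cases F (τ, Nat.pair a m) <;> simp
  set p : ℕ → Bool := fun m => decide ((F (τ, Nat.pair a m)).getD 0 = 0) with hp
  have hdef : functionalRfind F (τ, a) =
      if F (τ, Nat.pair a ((List.range τ.length).findIdx p)) = some 0 then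
        some ((List.range τ.length).findIdx p) else none := rfl
  have hle : (List.range τ.length).findIdx p ≤ τ.length := by
    simpa using List.findIdx_le_length (p := p) (xs := List.range τ.length)
  have hlt : ∀ m < (List.range τ.length).findIdx p, p m = false := by
    intro m hm
    simpa using List.not_of_lt_findIdx hm
  rw [hdef]
  constructor
  · intro h
    split_ifs at h with h0
    obtain rfl := Option.some.inj h
    refine ⟨hle, h0, fun m hm => (key m).1 ?_⟩
    simpa [hp] using hlt m hm
  · rintro ⟨hn, h0, hm⟩
    have : (List.range τ.length).findIdx p = n := by
      rcases lt_trichotomy ((List.range τ.length).findIdx p) n with h | h | h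
      · have h1 := List.findIdx_getElem (p := p) (xs := List.range τ.length)
          (w := by simpa using h.trans_le hn)
        have h2 := (key _).2 (hm _ h)
        simp [hp] at h1
        exact absurd h1 h2
      · exact h
      · have := hlt n h
        simp [hp, h0] at this
    rw [this, if_pos h0]

theorem IsFunctional.rfind {F : List Bool × ℕ → Option ℕ} (hF : IsFunctional F) :
    IsFunctional (functionalRfind F) := by
  refine ⟨?_, fun {τ τ'} h n v hv => ?_⟩
  · have h1 : Primrec fun q : (List Bool × ℕ) × ℕ => F (q.1.1, Nat.pair q.1.2 q.2) :=
      hF.primrec.comp (Primrec.pair (Primrec.fst.comp Primrec.fst)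
        (Primrec₂.natPair.comp (Primrec.snd.comp Primrec.fst) Primrec.snd))
    have hm : Primrec fun p : List Bool × ℕ => (List.range p.1.length).findIdx fun m =>
        decide ((F (p.1, Nat.pair p.2 m)).getD 0 = 0) :=
      Primrec.list_findIdx (Primrec.list_range.comp (Primrec.list_length.comp Primrec.fst))
        (Primrec.eq.decide.comp (Primrec.option_getD.comp h1 (Primrec.const 0))
          (Primrec.const 0)).to₂
    exact Primrec.ite (Primrec.eq.comp (h1.comp (Primrec.pair Primrec.id hm))
      (Primrec.const (some 0))) (Primrec.option_some.comp hm) (Primrec.const none)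
  · rw [functionalRfind_eq_some] at hv ⊢
    refine ⟨hv.1.trans h.length_le, hF.mono h hv.2.1, fun m hm => ?_⟩
    obtain ⟨c, hc, hm⟩ := hv.2.2 m hm
    exact ⟨c, hc, hF.mono h hm⟩

/-- Finitely many computations with oracle `X` have a common use. -/
theorem exists_use_forall_lt {F : List Bool × ℕ → Option ℕ} (hF : IsFunctional F) (X : ℕ → Bool)
    {P : ℕ → ℕ → ℕ → Prop} {n : ℕ}
    (h : ∀ m < n, ∃ k i v, P m i v ∧ F (initSeg X k, i) = some v) :
    ∃ k, ∀ m < n, ∃ i v, P m i v ∧ F (initSeg X k, i) = some v := by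
  induction n with
  | zero => exact ⟨0, by simp⟩
  | succ n ih =>
    obtain ⟨k, hk⟩ := ih fun m hm => h m (by omega)
    obtain ⟨k', i', v', hP, hk'⟩ := h n (by omega)
    refine ⟨max k k', fun m hm => ?_⟩
    rcases Nat.lt_succ_iff_lt_or_eq.1 hm with hm | rfl
    · obtain ⟨i, v, hP, hv⟩ := hk m hm
      exact ⟨i, v, hP, hF.mono_initSeg (le_max_left _ _) hv⟩
    · exact ⟨i', v', hP, hF.mono_initSeg (le_max_right _ _) hk'⟩

/-- Use principle, by induction on the derivation: a convergent computation consults finitely many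
bits, and by monotonicity the uses of its subcomputations can be replaced by their maximum. -/
theorem exists_functional_of_recursiveIn {X : ℕ → Bool} {d : ℕ →. ℕ}
    (hd : Nat.RecursiveIn {(charFn X : ℕ →. ℕ)} d) :
    ∃ F, IsFunctional F ∧ FunctionalComputes F X d := by
  induction hd with
  | zero => exact ⟨_, .of_primrec (Primrec.const 0), fun n v => by
      simp [eq_comm, show (0 : Part ℕ) = Part.some 0 from rfl]⟩
  | succ => exact ⟨_, .of_primrec Primrec.succ, fun n v => by simp [eq_comm]⟩
  | left => exact ⟨_, .of_primrec (Primrec.fst.comp Primrec.unpair), fun n v => by simp [eq_comm]⟩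
  | right => exact ⟨_, .of_primrec (Primrec.snd.comp Primrec.unpair), fun n v => by simp [eq_comm]⟩
  | oracle g hg =>
    refine ⟨_, .oracle, fun n v => ?_⟩
    obtain rfl := hg
    simp only [PFun.coe_val, Part.mem_some_iff, Option.map_eq_some_iff, getElem?_initSeg, charFn]
    constructor
    · rintro rfl
      exact ⟨n + 1, X n, ⟨by omega, rfl⟩, rfl⟩
    · rintro ⟨k, b, ⟨-, rfl⟩, rfl⟩
      rfl
  | pair _ _ ih₁ ih₂ =>
    obtain ⟨F, hF, hFd⟩ := ih₁
    obtain ⟨G, hG, hGd⟩ := ih₂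
    refine ⟨_, hF.pair hG, fun n v => ?_⟩
    simp only [Seq.seq, Part.map_eq_map, Part.mem_bind_iff, Part.mem_map_iff,
      Option.bind_eq_some_iff, Option.map_eq_some_iff, hFd n, hGd n]
    constructor
    · rintro ⟨_, ⟨a, ⟨k, hk⟩, rfl⟩, b, ⟨k', hk'⟩, rfl⟩
      exact ⟨max k k', a, hF.mono_initSeg (le_max_left _ _) hk, b,
        hG.mono_initSeg (le_max_right _ _) hk', rfl⟩
    · rintro ⟨k, a, ha, b, hb, rfl⟩
      exact ⟨_, ⟨a, ⟨k, ha⟩, rfl⟩, b, ⟨k, hb⟩, rfl⟩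
  | @comp f h _ _ ih₁ ih₂ =>
    obtain ⟨F, hF, hFd⟩ := ih₁
    obtain ⟨G, hG, hGd⟩ := ih₂
    refine ⟨_, hF.comp hG, fun n v => ?_⟩
    refine Part.mem_bind_iff.trans ?_
    simp only [Option.bind_eq_some_iff]
    constructor
    · rintro ⟨b, hb, hv⟩
      obtain ⟨k, hk⟩ := (hGd n b).1 hb
      obtain ⟨k', hk'⟩ := (hFd b v).1 hv
      exact ⟨max k k', b, hG.mono_initSeg (le_max_left _ _) hk,
        hF.mono_initSeg (le_max_right _ _) hk'⟩
    · rintro ⟨k, b, hb, hv⟩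
      exact ⟨b, (hGd n b).2 ⟨k, hb⟩, (hFd b v).2 ⟨k, hv⟩⟩
  | prec _ _ ih₁ ih₂ =>
    obtain ⟨F, hF, hFd⟩ := ih₁
    obtain ⟨G, hG, hGd⟩ := ih₂
    refine ⟨_, hF.prec hG, fun n v => ?_⟩
    simp only
    generalize n.unpair.1 = a
    generalize n.unpair.2 = m
    induction m generalizing v with
    | zero => exact hFd a v
    | succ m ih =>
      simp only [Part.bind_eq_bind, Part.mem_bind_iff, hGd _ _, functionalPrec,
        Option.bind_eq_some_iff]
      constructor
      · rintro ⟨i, hi, k', hk'⟩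
        obtain ⟨k, hk⟩ := (ih i).1 hi
        exact ⟨max k k', i,
          functionalPrec_mono hF hG (initSeg_prefix X (le_max_left _ _)) _ _ hk,
          hG.mono_initSeg (le_max_right _ _) hk'⟩
      · rintro ⟨k, i, hi, hv⟩
        exact ⟨i, (ih i).2 ⟨k, hi⟩, k, hv⟩
  | @rfind f _ ih =>
    obtain ⟨F, hF, hFd⟩ := ih
    refine ⟨_, hF.rfind, fun a n => ?_⟩
    have key : ∀ m (b : Bool),
        (b ∈ (show Part ℕ from f (Nat.pair a m)).map fun m => decide (m = 0)) ↔
          ∃ k c, decide (c = 0) = b ∧ F (initSeg X k, Nat.pair a m) = some c := by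
      intro m b
      rw [Part.mem_map_iff]
      constructor
      · rintro ⟨c, hc, rfl⟩
        obtain ⟨k, hk⟩ := (hFd _ c).1 hc
        exact ⟨k, c, rfl, hk⟩
      · rintro ⟨k, c, rfl, hk⟩
        exact ⟨c, (hFd _ c).2 ⟨k, hk⟩, rfl⟩
    refine Nat.mem_rfind.trans ?_
    simp only [functionalRfind_eq_some, length_initSeg]
    constructor
    · rintro ⟨h0, h⟩
      obtain ⟨k, c, hc, hk⟩ := (key n true).1 h0
      obtain rfl : c = 0 := by simpa using hc
      obtain ⟨k', hk'⟩ := exists_use_forall_lt hF X (n := n)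
        (P := fun m i v => i = Nat.pair a m ∧ v ≠ 0) fun m hm => by
          obtain ⟨k, c, hc, hk⟩ := (key m false).1 (h hm)
          exact ⟨k, _, c, ⟨rfl, by simpa using hc⟩, hk⟩
      -- Besides covering the uses `k` and `k'`, the prefix must have length at least `n` for the
      -- bounded search to reach `n`.
      refine ⟨max n (max k k'), le_max_left _ _, hF.mono_initSeg (by simp) hk, fun m hm => ?_⟩
      obtain ⟨_, v, ⟨rfl, hv⟩, hm⟩ := hk' m hm
      exact ⟨v, hv, hF.mono_initSeg (by simp) hm⟩
    · rintro ⟨k, -, h0, h⟩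
      refine ⟨(key n true).2 ⟨k, 0, rfl, h0⟩, fun {m} hm => (key m false).2 ?_⟩
      obtain ⟨c, hc, hm⟩ := h m hm
      exact ⟨k, c, by simpa using hc, hm⟩

/-! ### Monotonization and enumeration reductions -/

/-- The value of `G` on the shortest prefix of `τ` of length at most `j` where `G` is defined. -/
def firstValue (G : List Bool × ℕ → Option ℕ) (τ : List Bool) (n j : ℕ) : Option ℕ :=
  j.rec (G ([], n)) fun i IH => IH <|> G (τ.take (i + 1), n)

theorem firstValue_succ_eq_some {G : List Bool × ℕ → Option ℕ} {τ : List Bool} {n v j : ℕ} :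
    firstValue G τ n (j + 1) = some v ↔ firstValue G τ n j = some v ∨
      firstValue G τ n j = none ∧ G (τ.take (j + 1), n) = some v := by
  change (firstValue G τ n j <|> G (τ.take (j + 1), n)) = some v ↔ _
  cases firstValue G τ n j <;> simp

/-- Since `j ≤ τ.length`, only prefixes common to `τ` and `τ'` are inspected up to `j`, and a value
once found is never replaced. -/
theorem firstValue_mono {G : List Bool × ℕ → Option ℕ} {τ τ' : List Bool} (h : τ <+: τ')
    {n v j j' : ℕ} (hj : j ≤ τ.length) (hjj : j ≤ j') (hv : firstValue G τ n j = some v) :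
    firstValue G τ' n j' = some v := by
  have h1 : firstValue G τ' n j = firstValue G τ n j := by
    clear hv hjj
    induction j with
    | zero => rfl
    | succ j ih =>
      obtain ⟨t, rfl⟩ := h
      have := ih (by omega)
      simp only [firstValue] at this ⊢
      rw [this, List.take_append_of_le_length hj]
  induction j', hjj using Nat.le_induction with
  | base => rw [h1, hv]
  | succ i hi ih =>
    exact firstValue_succ_eq_some.2 (Or.inl ih)

theorem exists_of_firstValue {G : List Bool × ℕ → Option ℕ} {τ : List Bool} {n v j : ℕ}
    (hv : firstValue G τ n j = some v) : ∃ i ≤ j, G (τ.take i, n) = some v := by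
  induction j with
  | zero => exact ⟨0, le_rfl, by simpa [firstValue] using hv⟩
  | succ j ih =>
    rcases firstValue_succ_eq_some.1 hv with hv | ⟨-, hv⟩
    · obtain ⟨i, hi, h⟩ := ih hv
      exact ⟨i, by omega, h⟩
    · exact ⟨j + 1, le_rfl, hv⟩

theorem firstValue_isSome {G : List Bool × ℕ → Option ℕ} {τ : List Bool} {n v i j : ℕ}
    (hij : i ≤ j) (hv : G (τ.take i, n) = some v) : ∃ w, firstValue G τ n j = some w := by
  induction j, hij using Nat.le_induction with
  | base =>
    cases i with
    | zero => exact ⟨v, by simpa [firstValue] using hv⟩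
    | succ i =>
      by_cases h : firstValue G τ n i = none
      · exact ⟨v, firstValue_succ_eq_some.2 (Or.inr ⟨h, hv⟩)⟩
      · obtain ⟨w, hw⟩ := Option.ne_none_iff_exists'.1 h
        exact ⟨w, firstValue_succ_eq_some.2 (Or.inl hw)⟩
  | succ j _ ih =>
    obtain ⟨w, hw⟩ := ih
    exact ⟨w, firstValue_succ_eq_some.2 (Or.inl hw)⟩

/-- `G` itself may lose values as the string grows. Keeping the first value found repairs this, and
it is correct along `X` because everything `G` outputs there belongs to the single-valued `d n`. -/
theorem exists_functional_of_primrec {G : List Bool × ℕ → Option ℕ} (hG : Primrec G)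
    {X : ℕ → Bool} {d : ℕ →. ℕ} (hd : FunctionalComputes G X d) :
    ∃ F, IsFunctional F ∧ FunctionalComputes F X d := by
  refine ⟨fun p => firstValue G p.1 p.2 p.1.length, ⟨?_, fun h n v hv =>
    firstValue_mono h le_rfl h.length_le hv⟩, fun n v => ?_⟩
  · refine Primrec.nat_rec' (h := fun (p : List Bool × ℕ) (q : ℕ × Option ℕ) =>
      q.2 <|> G (p.1.take (q.1 + 1), p.2)) (Primrec.list_length.comp Primrec.fst)
      (hG.comp (Primrec.pair (Primrec.const []) Primrec.snd)) ?_
    exact Primrec.option_orElse.comp (Primrec.snd.comp Primrec.snd) (hG.comp (Primrec.pair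
      (Primrec.list_take.comp (Primrec.succ.comp (Primrec.fst.comp Primrec.snd))
        (Primrec.fst.comp Primrec.fst)) (Primrec.snd.comp Primrec.fst)))
  · have key : ∀ k v, firstValue G (initSeg X k) n (initSeg X k).length = some v → v ∈ d n := by
      intro k v hv
      obtain ⟨i, hi, h⟩ := exists_of_firstValue hv
      rw [take_initSeg X (by simpa using hi)] at h
      exact (hd n v).2 ⟨i, h⟩
    refine ⟨fun hv => ?_, fun ⟨k, hk⟩ => key k v hk⟩
    obtain ⟨k, hk⟩ := (hd n v).1 hv
    obtain ⟨w, hw⟩ := firstValue_isSome (τ := initSeg X k) (i := k) (j := (initSeg X k).length)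
      (by simp) (by rwa [take_initSeg X le_rfl])
    exact ⟨k, by rw [Part.mem_unique hv (key k w hw)]; exact hw⟩

/-- Membership in the graph of `charFn X` is settled by a single bit of `X`, so an axiom of `W` can
be checked on an initial segment. The length of the string doubles as a search index: its first
component codes an axiom and a stage at which it is enumerated, its second is padding. The result is
not monotone, hence the appeal to `exists_functional_of_primrec`. -/
theorem exists_functional_of_enumReducible {X : ℕ → Bool} {e : ℕ →. ℕ}
    (he : EnumReducible e (charFn X)) : ∃ F, IsFunctional F ∧ FunctionalComputes F X e := by
  obtain ⟨W, hW, hWe⟩ := he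
  obtain ⟨c, hc⟩ := Nat.Partrec.Code.exists_code.1 hW
  have hcW : ∀ p, p ∈ W ↔ ∃ s, (Nat.Partrec.Code.evaln s c (Encodable.encode p)).isSome := by
    intro p
    have h1 : p ∈ W ↔ (Nat.Partrec.Code.eval c (Encodable.encode p)).Dom := by
      rw [hc]
      simp only [Encodable.encodek, Part.coe_some, Part.bind_some]
      exact ⟨fun h => ⟨h, trivial⟩, fun h => h.1⟩
    rw [h1, Part.dom_iff_mem]
    simp only [Nat.Partrec.Code.evaln_complete, Option.isSome_iff_exists, Option.mem_def]
    exact ⟨fun ⟨y, k, h⟩ => ⟨k, y, h⟩, fun ⟨k, y, h⟩ => ⟨y, k, h⟩⟩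
  set good : List Bool → ℕ → (List ℕ × ℕ) × ℕ → Prop := fun τ n q =>
    q.1.2.unpair.1 = n ∧ (Nat.Partrec.Code.evaln q.2 c (Encodable.encode q.1)).isSome = true ∧
      ∀ x ∈ q.1.1, τ[x.unpair.1]?.map Bool.toNat = some x.unpair.2 with hgood
  set G : List Bool × ℕ → Option ℕ := fun p =>
    (Encodable.decode (α := (List ℕ × ℕ) × ℕ) p.1.length.unpair.1).bind fun q =>
      if good p.1 p.2 q then some q.1.2.unpair.2 else none with hG
  have hGp : Primrec G := by
    refine Primrec.option_bind (Primrec.decode.comp (Primrec.fst.comp (Primrec.unpair.comp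
      (Primrec.list_length.comp Primrec.fst)))) ?_
    refine Primrec.ite (c := fun a : (List Bool × ℕ) × ((List ℕ × ℕ) × ℕ) => good a.1.1 a.1.2 a.2)
      ?_ ?_ (Primrec.const none)
    · have hq : Primrec fun a : (List Bool × ℕ) × ((List ℕ × ℕ) × ℕ) => a.2.1 :=
        Primrec.fst.comp Primrec.snd
      refine PrimrecPred.and (Primrec.eq.comp (Primrec.fst.comp (Primrec.unpair.comp
        (Primrec.snd.comp hq))) (Primrec.snd.comp Primrec.fst)) (PrimrecPred.and ?_ ?_)
      · exact Primrec.eq.comp (Primrec.option_isSome.comp (Nat.Partrec.Code.primrec_evaln.comp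
          (Primrec.pair (Primrec.pair (Primrec.snd.comp Primrec.snd) (Primrec.const c))
            (Primrec.encode.comp hq)))) (Primrec.const true)
      · have hR : PrimrecRel fun (x : ℕ) (τ : List Bool) =>
            τ[x.unpair.1]?.map Bool.toNat = some x.unpair.2 :=
          Primrec.eq.comp (Primrec.option_map₁ (Primrec.dom_bool _) |>.comp
            (Primrec.list_getElem?.comp Primrec.snd (Primrec.fst.comp (Primrec.unpair.comp
              Primrec.fst)))) (Primrec.option_some.comp (Primrec.snd.comp (Primrec.unpair.comp
              Primrec.fst)))
        exact hR.forall_mem_list.comp (Primrec.fst.comp hq) (Primrec.fst.comp Primrec.fst)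
    · exact Primrec.option_some.comp (Primrec.snd.comp (Primrec.unpair.comp (Primrec.snd.comp
        (Primrec.fst.comp Primrec.snd))))
  refine exists_functional_of_primrec hGp (X := X) fun n v => ?_
  have h1 : v ∈ e n ↔ Nat.pair n v ∈ enumApply W (graphOf (charFn X)) := by
    rw [hWe]; simp [graphOf]
  have h2 : ∀ x, x ∈ graphOf (charFn X) ↔ (X x.unpair.1).toNat = x.unpair.2 := by
    intro x; simp [graphOf, charFn, eq_comm]
  rw [h1]
  simp only [enumApply, Set.mem_ofPred_eq, h2, hcW]
  constructor
  · rintro ⟨L, ⟨s, hs⟩, hL⟩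
    -- The padding exceeds every element of `L`, so a string of length `t` contains all the bits
    -- that the axiom asks about.
    set t := Nat.pair (Encodable.encode ((L, Nat.pair n v), s))
      (L.foldr (fun x b => max (x + 1) b) 0) with ht
    have hlt : ∀ x ∈ L, x.unpair.1 < t := by
      intro x hx
      have h3 : x + 1 ≤ L.foldr (fun x b => max (x + 1) b) 0 := by
        clear hs hL ht t
        induction L with
        | nil => simp at hx
        | cons a l ih =>
          rcases List.mem_cons.1 hx with rfl | hx
          · simp
          · simp [ih hx]
      exact (Nat.unpair_left_le x).trans_lt (h3.trans (Nat.right_le_pair _ _))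
    refine ⟨t, ?_⟩
    simp only [hG, length_initSeg, ht, Nat.unpair_pair, Encodable.encodek, Option.bind_some]
    rw [if_pos]
    refine ⟨by simp, hs, fun x hx => ?_⟩
    rw [Option.map_eq_some_iff]
    exact ⟨X x.unpair.1, (getElem?_initSeg _ _ _ _).2 ⟨hlt x hx, rfl⟩, hL x hx⟩
  · rintro ⟨k, hk⟩
    simp only [hG, Option.bind_eq_some_iff] at hk
    obtain ⟨⟨⟨L, m⟩, s⟩, -, hk⟩ := hk
    split_ifs at hk with hg
    obtain ⟨hm, hs, hL⟩ := hg
    have hmm : m = Nat.pair n v := by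
      rw [← Nat.pair_unpair m]
      simp only [Option.some.injEq] at hk
      rw [← hk, ← hm]
    subst hmm
    refine ⟨L, ⟨s, hs⟩, fun x hx => ?_⟩
    obtain ⟨b, hb, hb'⟩ := Option.map_eq_some_iff.1 (hL x hx)
    rw [((getElem?_initSeg _ _ _ _).1 hb).2, hb']

/-! ### Fair coin measure and finite strings -/

/-- The list of all binary strings of length `s`. -/
def strings (s : ℕ) : List (List Bool) :=
  s.rec [[]] fun _ L => L.map (List.cons false) ++ L.map (List.cons true)

theorem mem_strings {s : ℕ} {ρ : List Bool} : ρ ∈ strings s ↔ ρ.length = s := by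
  induction s generalizing ρ with
  | zero => simp [strings]
  | succ s ih =>
    change ρ ∈ (strings s).map (List.cons false) ++ (strings s).map (List.cons true) ↔ _
    rcases ρ with _ | ⟨b, ρ⟩
    · simp
    · cases b <;> simp [ih]

theorem nodup_strings (s : ℕ) : (strings s).Nodup := by
  induction s with
  | zero => simp [strings]
  | succ s ih =>
    change ((strings s).map (List.cons false) ++ (strings s).map (List.cons true)).Nodup
    refine List.Nodup.append (ih.map List.cons_injective) (ih.map List.cons_injective) ?_
    intro ρ h₁ h₂
    simp only [List.mem_map] at h₁ h₂
    obtain ⟨a, -, rfl⟩ := h₁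
    obtain ⟨b, -, h⟩ := h₂
    simp at h

theorem length_strings (s : ℕ) : (strings s).length = 2 ^ s := by
  induction s with
  | zero => simp [strings]
  | succ s ih =>
    change ((strings s).map (List.cons false) ++ (strings s).map (List.cons true)).length = _
    simp [ih, pow_succ, mul_two]

theorem primrec_strings : Primrec strings := by
  have h : ∀ b : Bool, Primrec₂ fun (_ : ℕ) (L : List (List Bool)) => L.map (List.cons b) :=
    fun b => Primrec.list_map Primrec.snd (Primrec.list_cons.comp (Primrec.const b) Primrec.snd)
  exact Primrec.nat_rec₁ [[]] (Primrec.list_append.comp (h false) (h true))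

instance : IsProbabilityMeasure cantorMeasure := by
  unfold cantorMeasure; infer_instance

theorem initSeg_eq_iff {X Y : ℕ → Bool} {s : ℕ} :
    initSeg X s = initSeg Y s ↔ ∀ i < s, X i = Y i := by
  simp [initSeg]

theorem exists_initSeg_eq (ρ : List Bool) : ∃ X, initSeg X ρ.length = ρ := by
  refine ⟨fun i => ρ.getD i false, List.ext_getElem (by simp) fun i h₁ h₂ => ?_⟩
  simp [initSeg, h₂]

theorem cantorMeasure_initSeg_eq (ρ : List Bool) :
    cantorMeasure.real {X | initSeg X ρ.length = ρ} = (1 / 2) ^ ρ.length := by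
  obtain ⟨Y, hY⟩ := exists_initSeg_eq ρ
  have h1 : {X | initSeg X ρ.length = ρ} =
      Set.pi (Finset.range ρ.length : Set ℕ) fun i => {Y i} := by
    ext X
    nth_rewrite 2 [← hY]
    simp [initSeg_eq_iff]
  rw [h1, measureReal_def, cantorMeasure, Measure.infinitePi_pi _ fun _ _ => .singleton _]
  simp

theorem measurableSet_initSeg (s : ℕ) (P : List Bool → Prop) :
    MeasurableSet {X | P (initSeg X s)} := by
  have h : {X : ℕ → Bool | P (initSeg X s)} =
      (fun X (i : Fin s) => X i) ⁻¹' {x | P (List.ofFn x)} := by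
    ext X
    have : initSeg X s = List.ofFn fun i : Fin s => X i :=
      List.ext_getElem (by simp) fun i h₁ h₂ => by simp [initSeg]
    simp [this]
  rw [h]
  exact (measurable_pi_lambda _ fun i => measurable_pi_apply _) (Set.toFinite _).measurableSet

theorem cantorMeasure_initSeg_mem {s : ℕ} {L : List (List Bool)} (hL : L.Nodup)
    (hs : ∀ ρ ∈ L, ρ.length = s) :
    cantorMeasure.real {X | initSeg X s ∈ L} = L.length / 2 ^ s := by
  induction L with
  | nil => simp
  | cons ρ L ih =>
    obtain rfl := hs ρ (by simp)
    rw [List.nodup_cons] at hL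
    have h1 : {X | initSeg X ρ.length ∈ ρ :: L} =
        {X | initSeg X ρ.length = ρ} ∪ {X | initSeg X ρ.length ∈ L} := by
      ext X; simp
    rw [h1, measureReal_union _ (measurableSet_initSeg _ (· ∈ L)), cantorMeasure_initSeg_eq,
      ih hL.2 fun τ hτ => hs τ (by simp [hτ])]
    · simp; ring
    · rw [Set.disjoint_left]
      intro X h₁ h₂
      have h₁ : initSeg X ρ.length = ρ := h₁
      have h₂ : initSeg X ρ.length ∈ L := h₂
      exact hL.1 (h₁ ▸ h₂)

theorem exists_cylinder_subset {U : Set (ℕ → Bool)} (hU : IsOpen U) {X : ℕ → Bool} (hX : X ∈ U) :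
    ∃ n, ∀ Y, initSeg Y n = initSeg X n → Y ∈ U := by
  obtain ⟨I, u, hu, hI⟩ := isOpen_pi_iff.1 hU X hX
  refine ⟨I.sup id + 1, fun Y hY => hI fun i hi => ?_⟩
  rw [initSeg_eq_iff.1 hY i (Nat.lt_succ_of_le (Finset.le_sup (f := id) hi))]
  exact (hu i hi).2

/-- Every class of positive measure fills more than half of some clopen class. -/
theorem exists_clopen_half_lt {C : Set (ℕ → Bool)} (hC : cantorMeasure C ≠ 0) :
    ∃ (n : ℕ) (L : List (List Bool)), L.Nodup ∧ (∀ ρ ∈ L, ρ.length = n) ∧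
      cantorMeasure.real {X | initSeg X n ∈ L} <
        2 * cantorMeasure.real (C ∩ {X | initSeg X n ∈ L}) := by
  classical
  have hC' : 0 < cantorMeasure.real C :=
    ENNReal.toReal_pos hC (measure_ne_top _ _)
  -- Outer regularity with the bound `2 * μ C`, strictly above `μ C` because `C` is not null and has
  -- finite measure.
  obtain ⟨U, hCU, hU, hlt⟩ := C.exists_isOpen_lt_of_lt (μ := cantorMeasure)
    (2 * cantorMeasure C) (by
      rw [two_mul]; exact ENNReal.lt_add_right (measure_ne_top _ _) hC)
  have hlt' : cantorMeasure.real U < 2 * cantorMeasure.real C := by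
    have := (ENNReal.toReal_lt_toReal (measure_ne_top _ _)
      (ENNReal.mul_ne_top (by simp) (measure_ne_top _ _))).2 hlt
    simpa [ENNReal.toReal_mul, measureReal_def] using this
  -- `K n` is the union of the length-`n` cylinders inside `U`. These clopen classes increase to
  -- `U`, so `2 * μ (C ∩ K n)` tends to `2 * μ C` and eventually exceeds `μ U`, which bounds `μ (K
  -- n)`.
  set K : ℕ → Set (ℕ → Bool) := fun n => {X | ∀ Y, initSeg Y n = initSeg X n → Y ∈ U} with hK
  have hmono : Monotone K := by
    intro n m hnm X hX Y hY
    exact hX Y (initSeg_eq_iff.2 fun i hi => initSeg_eq_iff.1 hY i (hi.trans_le hnm))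
  have hKU : ∀ n, K n ⊆ U := fun n X hX => hX X rfl
  have hUn : ⋃ n, C ∩ K n = C := by
    refine Set.Subset.antisymm (Set.iUnion_subset fun n => Set.inter_subset_left) fun X hX => ?_
    obtain ⟨n, hn⟩ := exists_cylinder_subset hU (hCU hX)
    exact Set.mem_iUnion.2 ⟨n, hX, hn⟩
  have htend : Tendsto (fun n => cantorMeasure (C ∩ K n)) atTop (𝓝 (cantorMeasure C)) := by
    have := tendsto_measure_iUnion_atTop (μ := cantorMeasure) (s := fun n => C ∩ K n)
      fun n m h => Set.inter_subset_inter_right _ (hmono h)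
    rwa [hUn] at this
  have htend' : Tendsto (fun n => 2 * cantorMeasure.real (C ∩ K n)) atTop
      (𝓝 (2 * cantorMeasure.real C)) :=
    ((ENNReal.tendsto_toReal (measure_ne_top _ _)).comp htend).const_mul 2
  obtain ⟨n, hn⟩ := (htend'.eventually (lt_mem_nhds hlt')).exists
  refine ⟨n, (strings n).filter fun ρ => ∀ Y, initSeg Y n = ρ → Y ∈ U,
    (nodup_strings n).filter _, fun ρ hρ => mem_strings.1 (List.mem_filter.1 hρ).1, ?_⟩
  have hKn : {X | initSeg X n ∈ (strings n).filter fun ρ => ∀ Y, initSeg Y n = ρ → Y ∈ U} =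
      K n := by
    ext X; simp [hK, mem_strings]
  rw [hKn]
  exact (measureReal_mono (hKU n)).trans_lt hn

/-! ### Density one as an arithmetical condition -/

theorem ncard_inter_Iio_le (S : Set ℕ) (n : ℕ) : (S ∩ Set.Iio n).ncard ≤ n := by
  calc (S ∩ Set.Iio n).ncard ≤ (Set.Iio n).ncard :=
        Set.ncard_le_ncard Set.inter_subset_right (Set.finite_Iio n)
    _ = n := by simp [Set.ncard_eq_toFinset_card']

/-- The thresholds `e / (e + 1)` tend to 1; with denominators cleared, the comparison is between
natural numbers and becomes decidable once the count is known. -/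
theorem hasDensity_one_iff {S : Set ℕ} :
    HasDensity S 1 ↔ ∀ e : ℕ, ∃ N, ∀ n ≥ N, e * n ≤ (e + 1) * (S ∩ Set.Iio n).ncard := by
  unfold HasDensity
  constructor
  · intro h e
    obtain ⟨N, hN⟩ := Filter.eventually_atTop.1 (h.eventually (lt_mem_nhds
      (show (e : ℝ) / (e + 1) < 1 by rw [div_lt_one (by positivity)]; linarith)))
    refine ⟨N, fun n hn => ?_⟩
    rcases Nat.eq_zero_or_pos n with rfl | hpos
    · simp
    have h1 := (hN n hn).le
    rw [densityBelow, div_le_div_iff₀ (by positivity) (by positivity)] at h1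
    have h2 : ((e * n : ℕ) : ℝ) ≤ ((e + 1) * (S ∩ Set.Iio n).ncard : ℕ) := by
      push_cast; linarith
    exact_mod_cast h2
  · intro h
    rw [Metric.tendsto_atTop]
    intro ε hε
    obtain ⟨e, he⟩ := exists_nat_one_div_lt hε
    obtain ⟨N, hN⟩ := h e
    refine ⟨N + 1, fun n hn => ?_⟩
    have hpos : (0 : ℝ) < n := by exact_mod_cast (by omega : 0 < n)
    have h1 : ((e * n : ℕ) : ℝ) ≤ ((e + 1) * (S ∩ Set.Iio n).ncard : ℕ) := by
      exact_mod_cast hN n (by omega)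
    have h2 : (((S ∩ Set.Iio n).ncard : ℕ) : ℝ) ≤ n := by exact_mod_cast ncard_inter_Iio_le S n
    have h3 : densityBelow S n ≤ 1 := (div_le_one hpos).2 h2
    have h4 : 1 - 1 / ((e : ℝ) + 1) ≤ densityBelow S n := by
      have : 1 - 1 / ((e : ℝ) + 1) = e / (e + 1) := by field_simp; ring
      rw [this, densityBelow, div_le_div_iff₀ (by positivity) hpos]
      push_cast at h1; linarith
    rw [Real.dist_eq, abs_sub_lt_iff]
    constructor <;> linarith

/-- The set of arguments at which `F` with oracle `X` outputs the value of `f`. -/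
def successSet (F : List Bool × ℕ → Option ℕ) (f : ℕ → ℕ) (X : ℕ → Bool) : Set ℕ :=
  {n | ∃ k, F (initSeg X k, n) = some (f n)}

/-- The number of arguments below the length of `T` at which `F` with oracle information `τ`
outputs the value listed in `T`. -/
def successCount (F : List Bool × ℕ → Option ℕ) (T : List ℕ) (τ : List Bool) : ℕ :=
  ((List.range T.length).filter fun k => F (τ, k) = T[k]?).length

theorem primrec_successCount {F : List Bool × ℕ → Option ℕ} (hF : Primrec F) :
    Primrec₂ (successCount F) := by
  have hR : PrimrecRel fun (k : ℕ) (q : List ℕ × List Bool) => F (q.2, k) = q.1[k]? :=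
    Primrec.eq.comp (hF.comp (Primrec.pair (Primrec.snd.comp Primrec.snd) Primrec.fst))
      (Primrec.list_getElem?.comp (Primrec.fst.comp Primrec.snd) Primrec.fst)
  exact Primrec.list_length.comp (hR.listFilter.comp
    (Primrec.list_range.comp (Primrec.list_length.comp Primrec.fst)) Primrec.id)

theorem successCount_eq (F : List Bool × ℕ → Option ℕ) (f : ℕ → ℕ) (n : ℕ) (τ : List Bool) :
    successCount F ((List.range n).map f) τ =
      ({k | F (τ, k) = some (f k)} ∩ Set.Iio n).ncard := by
  classical
  have h : ({k | F (τ, k) = some (f k)} ∩ Set.Iio n) =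
      (((List.range n).filter fun k => F (τ, k) = some (f k)).toFinset : Set ℕ) := by
    ext k; simp [and_comm]
  rw [h, Set.ncard_coe_finset, List.toFinset_card_of_nodup (List.nodup_range.filter _),
    successCount]
  simp only [List.length_map, List.length_range]
  congr 1
  refine List.filter_congr fun k hk => ?_
  simp [List.mem_range.1 hk]

/-- Only finitely many successes below `n` matter, so one prefix witnesses them all. A lower bound
on the count therefore costs a single existential quantifier. -/
theorem le_ncard_successSet_iff {F : List Bool × ℕ → Option ℕ} (hF : IsFunctional F) (f : ℕ → ℕ)
    (X : ℕ → Bool) (n m c : ℕ) : m ≤ c * (successSet F f X ∩ Set.Iio n).ncard ↔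
      ∃ s, m ≤ c * successCount F ((List.range n).map f) (initSeg X s) := by
  simp only [successCount_eq]
  constructor
  · intro h
    have : ∀ k, ∃ s, k ∈ successSet F f X → F (initSeg X s, k) = some (f k) := by
      intro k
      by_cases hk : k ∈ successSet F f X
      · obtain ⟨s, hs⟩ := hk
        exact ⟨s, fun _ => hs⟩
      · exact ⟨0, fun h => absurd h hk⟩
    choose s hs using this
    refine ⟨(Finset.range n).sup s, h.trans (Nat.mul_le_mul_left _ (Set.ncard_le_ncard ?_
      ((Set.finite_Iio n).subset Set.inter_subset_right)))⟩
    rintro k ⟨hk, hkn⟩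
    exact ⟨hF.mono_initSeg (Finset.le_sup (Finset.mem_range.2 hkn)) (hs k hk), hkn⟩
  · rintro ⟨s, hs⟩
    refine hs.trans (Nat.mul_le_mul_left _ (Set.ncard_le_ncard ?_
      ((Set.finite_Iio n).subset Set.inter_subset_right)))
    rintro k ⟨hk, hkn⟩
    exact ⟨⟨s, hk⟩, hkn⟩

/-! ### Computability from finite tables of an oracle -/

namespace Nat.RecursiveIn

variable {O : Set (ℕ →. ℕ)} {g h : ℕ → ℕ}

theorem comp_total (hg : Nat.RecursiveIn O fun n => Part.some (g n))
    (hh : Nat.RecursiveIn O fun n => Part.some (h n)) :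
    Nat.RecursiveIn O fun n => Part.some (g (h n)) :=
  (hg.comp hh).of_eq fun _ => Part.bind_some _ _

theorem pair_total (hg : Nat.RecursiveIn O fun n => Part.some (g n))
    (hh : Nat.RecursiveIn O fun n => Part.some (h n)) :
    Nat.RecursiveIn O fun n => Part.some (Nat.pair (g n) (h n)) :=
  (hg.pair hh).of_eq fun n => by simp [Seq.seq]

theorem prec_total (c : ℕ) (hg : Nat.RecursiveIn O fun n => Part.some (g n)) :
    Nat.RecursiveIn O fun n => Part.some (n.rec c fun y i => g (Nat.pair y i) : ℕ) := by
  have hp : Nat.RecursiveIn O fun n => Part.some n.unpair.2 := .right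
  have h := (Nat.RecursiveIn.prec (Nat.Primrec.recursiveIn (Nat.Primrec.const c))
    (hg.comp_total hp)).comp (Nat.Primrec.recursiveIn ((Nat.Primrec.const 0).pair .id))
  refine h.of_eq fun n => (Part.bind_some _ _).trans ?_
  simp only [Nat.unpair_pair, id]
  induction n with
  | zero => rfl
  | succ n ih => exact (congrArg (fun p => Part.bind p _) ih).trans (by simp)

end Nat.RecursiveIn

theorem recursiveIn_table (f : ℕ → ℕ) :
    Nat.RecursiveIn {(f : ℕ →. ℕ)}
      fun n => Part.some (Encodable.encode ((List.range n).map f)) := by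
  have horacle : Nat.RecursiveIn {(f : ℕ →. ℕ)} fun n => Part.some (f n) := .oracle _ rfl
  have hstep : Nat.Primrec fun z : ℕ => Encodable.encode
      (((Encodable.decode z.unpair.1 : Option (List ℕ)).getD []) ++ [z.unpair.2]) := by
    rw [← Primrec.nat_iff]
    exact Primrec.encode.comp (Primrec.list_concat.comp (Primrec.option_getD.comp
      (Primrec.decode.comp (Primrec.fst.comp Primrec.unpair)) (Primrec.const []))
      (Primrec.snd.comp Primrec.unpair))
  have h := Nat.RecursiveIn.prec_total (Encodable.encode ([] : List ℕ))
    (hstep.recursiveIn.comp_total (Nat.RecursiveIn.pair_total .right (horacle.comp_total .left)))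
  refine h.of_eq fun n => congrArg Part.some ?_
  induction n with
  | zero => rfl
  | succ n ih =>
    simp only at ih ⊢
    rw [ih]
    simp [List.range_succ]

/-- All use of the oracle is confined to tabulating `f` below a primitive recursive bound; the rest
is primitive recursive in the table. -/
theorem computableIn_of_table {α σ : Type*} [Primcodable α] [Primcodable σ] (f : ℕ → ℕ)
    {b : α → ℕ} (hb : Primrec b) {H : List ℕ → α → σ} (hH : Primrec₂ H) :
    ComputableIn {(f : ℕ →. ℕ)} fun a => H ((List.range (b a)).map f) a := by
  have hb' : Nat.Primrec fun n : ℕ => ((Encodable.decode n : Option α).map b).getD 0 := by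
    rw [← Primrec.nat_iff]
    exact Primrec.option_getD.comp (Primrec.option_map Primrec.decode (hb.comp Primrec.snd).to₂)
      (Primrec.const 0)
  have hQ : Nat.Partrec fun z : ℕ => ((((Encodable.decode z.unpair.1 : Option α).bind fun a =>
      (Encodable.decode z.unpair.2 : Option (List ℕ)).map fun t =>
        Encodable.encode (H t a)) : Option ℕ) : Part ℕ) := by
    refine Partrec.nat_iff.1 (Computable.ofOption (Primrec.to_comp ?_))
    refine Primrec.option_bind (Primrec.decode.comp (Primrec.fst.comp Primrec.unpair)) ?_
    refine Primrec.option_map (Primrec.decode.comp (Primrec.snd.comp (Primrec.unpair.comp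
      Primrec.fst))) ?_
    exact Primrec.encode.comp (hH.comp Primrec.snd (Primrec.snd.comp Primrec.fst))
  have h := hQ.recursiveIn.comp (Nat.RecursiveIn.pair_total Nat.Primrec.id.recursiveIn
    ((recursiveIn_table f).comp_total hb'.recursiveIn))
  refine h.of_eq fun n => (Part.bind_some _ _).trans ?_
  cases hn : (Encodable.decode n : Option α) <;> simp [hn]

/-! ### The complement of a success class is `Σ⁰₄` -/

theorem IsUniformSigma.succ {f : ℕ → ℕ} {n : ℕ} {D : ℕ → Set (ℕ → Bool)}
    (hD : IsUniformSigma f n D) :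
    IsUniformSigma f (n + 1) fun i => ⋃ k, (D (Nat.pair i k))ᶜ :=
  ⟨D, hD, fun _ => rfl⟩

/-- With `i` coding `(e, N, n, s)`, the table `T` of values below `n` and the oracle information
`τ`, the relation `n ≥ N` and the success ratio below `n` is less than `e / (e + 1)`. -/
def lowSuccess (F : List Bool × ℕ → Option ℕ) (i : ℕ) (T : List ℕ) (τ : List Bool) : Bool :=
  decide (i.unpair.1.unpair.1.unpair.2 ≤ i.unpair.1.unpair.2 ∧
    (i.unpair.1.unpair.1.unpair.1.unpair.2 + 1) * successCount F T τ <
      i.unpair.1.unpair.1.unpair.1.unpair.2 * i.unpair.1.unpair.2)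

theorem primrec_lowSuccess {F : List Bool × ℕ → Option ℕ} (hF : Primrec F) :
    Primrec₂ fun (T : List ℕ) (p : ℕ × List Bool) => lowSuccess F p.1 T p.2 := by
  have hl : ∀ {g : List ℕ × (ℕ × List Bool) → ℕ}, Primrec g → Primrec fun a => (g a).unpair.1 :=
    fun h => Primrec.fst.comp (Primrec.unpair.comp h)
  have hr : ∀ {g : List ℕ × (ℕ × List Bool) → ℕ}, Primrec g → Primrec fun a => (g a).unpair.2 :=
    fun h => Primrec.snd.comp (Primrec.unpair.comp h)
  have hi : Primrec fun a : List ℕ × (ℕ × List Bool) => a.2.1 := Primrec.fst.comp Primrec.snd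
  exact (PrimrecPred.and (Primrec.nat_le.comp (hr (hl (hl hi))) (hr (hl hi)))
    (Primrec.nat_lt.comp (Primrec.nat_mul.comp (Primrec.succ.comp (hr (hl (hl (hl hi)))))
      ((primrec_successCount hF).comp Primrec.fst (Primrec.snd.comp Primrec.snd)))
      (Primrec.nat_mul.comp (hr (hl (hl (hl hi)))) (hr (hl hi))))).decide

theorem isUniformSigma_zero_lowSuccess {F : List Bool × ℕ → Option ℕ} (hF : Primrec F)
    (f : ℕ → ℕ) : IsUniformSigma f 0 fun i => {X | lowSuccess F i
      ((List.range i.unpair.1.unpair.2).map f) (initSeg X i.unpair.2) = true} := by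
  have hbound : Primrec fun p : ℕ × List Bool => p.1.unpair.1.unpair.2 :=
    Primrec.snd.comp (Primrec.unpair.comp (Primrec.fst.comp (Primrec.unpair.comp Primrec.fst)))
  exact ⟨fun i => i.unpair.2, _, (Primrec.snd.comp Primrec.unpair).computableIn,
    computableIn_of_table f hbound (primrec_lowSuccess hF), fun i => rfl⟩

theorem isSigmaClass_not_hasDensity {F : List Bool × ℕ → Option ℕ} (hF : IsFunctional F)
    (f : ℕ → ℕ) : IsSigmaClass f 4 {X | HasDensity (successSet F f X) 1}ᶜ := by
  -- The four unions of complements bind `e`, `N`, `n`, `s` in this order, and the nested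
  -- complements turn them into ∃e ∀N ∃n ∀s applied to `lowSuccess`.
  refine ⟨_, (isUniformSigma_zero_lowSuccess hF.primrec f).succ.succ.succ.succ, ?_⟩
  ext X
  simp only [lowSuccess, Set.mem_compl_iff, Set.mem_ofPred_eq, Set.mem_iUnion,
    Nat.unpair_pair, hasDensity_one_iff, le_ncard_successSet_iff hF, decide_eq_true_eq]
  push Not
  simp only [forall_and, forall_const, ge_iff_le]

/-! ### Majority vote -/

theorem IsFunctional.monotone_setOf {F : List Bool × ℕ → Option ℕ} (hF : IsFunctional F)
    (n v : ℕ) : Monotone fun s => {X | F (initSeg X s, n) = some v} :=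
  fun _ _ h _ hX => hF.mono_initSeg h hX

/-- The number of strings of length `s` on which `F` outputs `v` at `n`. -/
def votes (F : List Bool × ℕ → Option ℕ) (n v s : ℕ) : ℕ :=
  ((strings s).filter fun ρ => F (ρ, n) = some v).length

theorem cantorMeasure_eq_votes (F : List Bool × ℕ → Option ℕ) (n v s : ℕ) :
    cantorMeasure.real {X | F (initSeg X s, n) = some v} = votes F n v s / 2 ^ s := by
  rw [votes, ← cantorMeasure_initSeg_mem ((nodup_strings s).filter _)
    fun ρ hρ => mem_strings.1 (List.mem_filter.1 hρ).1]
  congr 1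
  ext X
  simp [mem_strings]

/-- The class of oracles for which `F` outputs `v` at `n`. -/
def outputClass (F : List Bool × ℕ → Option ℕ) (n v : ℕ) : Set (ℕ → Bool) :=
  {X | ∃ s, F (initSeg X s, n) = some v}

theorem outputClass_eq_iUnion (F : List Bool × ℕ → Option ℕ) (n v : ℕ) :
    outputClass F n v = ⋃ s, {X | F (initSeg X s, n) = some v} := by
  ext X; simp [outputClass]

theorem measurableSet_outputClass (F : List Bool × ℕ → Option ℕ) (n v : ℕ) :
    MeasurableSet (outputClass F n v) := by
  rw [outputClass_eq_iUnion]
  exact MeasurableSet.iUnion fun s => measurableSet_initSeg s fun ρ => F (ρ, n) = some v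

/-- By monotonicity the class is an increasing union of clopen stages, so continuity from below
makes exceeding a threshold visible at a finite stage. -/
theorem lt_cantorMeasure_outputClass_iff {F : List Bool × ℕ → Option ℕ} (hF : IsFunctional F)
    (n v : ℕ) (r : ℝ) :
    r < cantorMeasure.real (outputClass F n v) ↔ ∃ s, r < votes F n v s / 2 ^ s := by
  simp only [← cantorMeasure_eq_votes]
  constructor
  · intro h
    have h1 := tendsto_measure_iUnion_atTop (μ := cantorMeasure) (hF.monotone_setOf n v)
    rw [← outputClass_eq_iUnion] at h1
    exact (((ENNReal.tendsto_toReal (measure_ne_top _ _)).comp h1).eventually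
      (lt_mem_nhds h)).exists
  · rintro ⟨s, hs⟩
    exact hs.trans_le (measureReal_mono fun X hX => ⟨s, hX⟩)

theorem disjoint_outputClass {F : List Bool × ℕ → Option ℕ} (hF : IsFunctional F) {n v w : ℕ}
    (hvw : v ≠ w) : Disjoint (outputClass F n v) (outputClass F n w) := by
  rw [Set.disjoint_left]
  rintro X ⟨s, hs⟩ ⟨t, ht⟩
  have h1 := hF.mono_initSeg (le_max_left s t) hs
  have h2 := hF.mono_initSeg (le_max_right s t) ht
  exact hvw (Option.some.inj (h1.symm.trans h2))

/-- The values receiving more than `a / c` of the votes are found by a computable search. -/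
theorem partrec_majority {F : List Bool × ℕ → Option ℕ} (hF : IsFunctional F) (a c : ℕ) :
    Nat.Partrec fun n => Nat.rfindOpt fun q =>
      if a * (strings q.unpair.1).length < c * votes F n q.unpair.2 q.unpair.1
        then some q.unpair.2 else none := by
  refine Partrec.nat_iff.1 (Partrec.rfindOpt (Primrec₂.to_comp ?_))
  have hq : Primrec fun p : ℕ × ℕ => p.2.unpair := Primrec.unpair.comp Primrec.snd
  have hs := primrec_strings.comp (Primrec.fst.comp hq)
  have hR : PrimrecRel fun (ρ : List Bool) (q : ℕ × ℕ) => F (ρ, q.1) = some q.2 :=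
    Primrec.eq.comp (hF.primrec.comp (Primrec.pair Primrec.fst (Primrec.fst.comp Primrec.snd)))
      (Primrec.option_some.comp (Primrec.snd.comp Primrec.snd))
  have hv : Primrec fun p : ℕ × ℕ => votes F p.1 p.2.unpair.2 p.2.unpair.1 :=
    Primrec.list_length.comp (hR.listFilter.comp hs
      (Primrec.pair Primrec.fst (Primrec.snd.comp hq)))
  exact Primrec.ite (Primrec.nat_lt.comp
    (Primrec.nat_mul.comp (Primrec.const a) (Primrec.list_length.comp hs))
    (Primrec.nat_mul.comp (Primrec.const c) hv))
    (Primrec.option_some.comp (Primrec.snd.comp hq)) (Primrec.const none)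

theorem exists_partrec_majority {F : List Bool × ℕ → Option ℕ} (hF : IsFunctional F)
    {K : Set (ℕ → Bool)} (hK : ∀ n v, outputClass F n v ⊆ K) {a k : ℕ}
    (hmK : cantorMeasure.real K = a / 2 ^ k) :
    ∃ d : ℕ →. ℕ, Nat.Partrec d ∧
      ∀ n v, cantorMeasure.real K / 2 < cantorMeasure.real (outputClass F n v) → v ∈ d n := by
  refine ⟨_, partrec_majority hF a (2 ^ (k + 1)), fun n v hv => ?_⟩
  -- The exponent `k + 1` absorbs both the denominator of `μ K` and the factor one half.
  have hcond : ∀ w s, a * (strings s).length < 2 ^ (k + 1) * votes F n w s ↔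
      cantorMeasure.real K / 2 < votes F n w s / 2 ^ s := by
    intro w s
    rw [hmK, length_strings, div_div, ← pow_succ, div_lt_div_iff₀ (by positivity) (by positivity),
      mul_comm (votes F n w s : ℝ)]
    exact_mod_cast Iff.rfl
  have hdom : (Nat.rfindOpt fun q =>
      if a * (strings q.unpair.1).length < 2 ^ (k + 1) * votes F n q.unpair.2 q.unpair.1
        then some q.unpair.2 else none).Dom := by
    obtain ⟨s, hs⟩ := (lt_cantorMeasure_outputClass_iff hF n v _).1 hv
    refine Nat.rfindOpt_dom.2 ⟨Nat.pair s v, v, ?_⟩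
    simp only [Nat.unpair_pair, Option.mem_def]
    rw [if_pos ((hcond v s).2 hs)]
  obtain ⟨w, hw⟩ := Part.dom_iff_mem.1 hdom
  obtain ⟨q, hq⟩ := Nat.rfindOpt_spec hw
  simp only [Option.mem_def] at hq
  split_ifs at hq with hlt
  obtain rfl := Option.some.inj hq
  have hw' := (lt_cantorMeasure_outputClass_iff hF n _ _).2 ⟨_, (hcond _ _).1 hlt⟩
  -- A different winner is impossible: two disjoint subclasses of `K` would each have more than half
  -- its measure.
  by_cases hvw : v = q.unpair.2
  · rw [hvw]; exact hw
  · have h1 := measureReal_union (μ := cantorMeasure) (disjoint_outputClass hF (n := n) hvw)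
      (measurableSet_outputClass F n _)
    have h2 : cantorMeasure.real (outputClass F n v ∪ outputClass F n q.unpair.2) ≤
        cantorMeasure.real K := measureReal_mono (Set.union_subset (hK n v) (hK n _))
    linarith

/-! ### Averaging -/

theorem densityBelow_eq_sum (S : Set ℕ) (n : ℕ) :
    densityBelow S n = (∑ k ∈ Finset.range n, S.indicator (fun _ => (1 : ℝ)) k) / n := by
  classical
  have h : S ∩ Set.Iio n = ((Finset.range n).filter fun k => k ∈ S : Finset ℕ) := by
    ext k; simp [and_comm]
  rw [densityBelow, h, Set.ncard_coe_finset]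
  simp [Set.indicator_apply]

theorem densityBelow_nonneg (S : Set ℕ) (n : ℕ) : 0 ≤ densityBelow S n := by
  unfold densityBelow; positivity

theorem densityBelow_le_one (S : Set ℕ) (n : ℕ) : densityBelow S n ≤ 1 :=
  div_le_one_of_le₀ (by exact_mod_cast ncard_inter_Iio_le S n) (by positivity)

/-- Passing from a function of the argument to a function of the oracle is what lets the average
over arguments and the integral over oracles be interchanged. -/
theorem indicator_successSet (F : List Bool × ℕ → Option ℕ) (f : ℕ → ℕ) (X : ℕ → Bool) (k : ℕ) :
    (successSet F f X).indicator (fun _ => (1 : ℝ)) k =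
      (outputClass F k (f k)).indicator (fun _ => (1 : ℝ)) X := rfl

theorem measurable_densityBelow_successSet (F : List Bool × ℕ → Option ℕ) (f : ℕ → ℕ) (n : ℕ) :
    Measurable fun X => densityBelow (successSet F f X) n := by
  simp only [densityBelow_eq_sum, indicator_successSet]
  exact (Finset.measurable_sum _ fun k _ =>
    measurable_const.indicator (measurableSet_outputClass F k (f k))).div_const _

theorem measurableSet_hasDensity_successSet (F : List Bool × ℕ → Option ℕ) (f : ℕ → ℕ) (r : ℝ) :
    MeasurableSet {X | HasDensity (successSet F f X) r} :=
  measurableSet_tendsto _ (measurable_densityBelow_successSet F f)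

theorem setIntegral_densityBelow_successSet (F : List Bool × ℕ → Option ℕ) (f : ℕ → ℕ)
    (D : Set (ℕ → Bool)) (n : ℕ) :
    ∫ X in D, densityBelow (successSet F f X) n ∂cantorMeasure =
      (∑ k ∈ Finset.range n, cantorMeasure.real (outputClass F k (f k) ∩ D)) / n := by
  simp only [densityBelow_eq_sum, indicator_successSet]
  rw [integral_div, integral_finsetSum]
  · congr 1
    refine Finset.sum_congr rfl fun k _ => ?_
    rw [integral_indicator_const _ (measurableSet_outputClass F k (f k)),
      measureReal_restrict_apply (measurableSet_outputClass F k (f k))]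
    simp
  · exact fun k _ => (integrable_const 1).indicator (measurableSet_outputClass F k (f k))

theorem tendsto_setIntegral_densityBelow (F : List Bool × ℕ → Option ℕ) (f : ℕ → ℕ) :
    Tendsto (fun n => ∫ X in {X | HasDensity (successSet F f X) 1},
      densityBelow (successSet F f X) n ∂cantorMeasure) atTop
      (𝓝 (cantorMeasure.real {X | HasDensity (successSet F f X) 1})) := by
  have h := tendsto_integral_of_dominated_convergence
    (μ := cantorMeasure.restrict {X | HasDensity (successSet F f X) 1})
    (F := fun n X => densityBelow (successSet F f X) n) (f := fun _ => (1 : ℝ)) (fun _ => 1)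
    (fun n => (measurable_densityBelow_successSet F f n).aestronglyMeasurable)
    (integrable_const 1)
    (fun n => Eventually.of_forall fun X => by
      rw [Real.norm_of_nonneg (densityBelow_nonneg _ _)]; exact densityBelow_le_one _ _)
    (ae_restrict_of_forall_mem (measurableSet_hasDensity_successSet F f 1) fun X hX => hX)
  simpa using h

/-- If the class of successful oracles has measure greater than `r`, then the arguments at which
the correct value is output with probability greater than `r` have density `1`. -/
theorem hasDensity_majority (F : List Bool × ℕ → Option ℕ) (f : ℕ → ℕ) {r : ℝ}
    (hr : r < cantorMeasure.real {X | HasDensity (successSet F f X) 1}) :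
    HasDensity {n | r < cantorMeasure.real (outputClass F n (f n))} 1 := by
  set D := {X | HasDensity (successSet F f X) 1} with hD
  set c := cantorMeasure.real D with hc
  set G : Set ℕ := {n | r < cantorMeasure.real (outputClass F n (f n))} with hG
  -- Arguments in `G` contribute at most `c`, all others at most `r`. Averaging bounds the integral
  -- by `r + (c - r) * densityBelow G n`; as the integral tends to `c`, the density of `G` is forced
  -- to 1.
  have hq : ∀ k, cantorMeasure.real (outputClass F k (f k) ∩ D) ≤
      r + (c - r) * G.indicator (fun _ => (1 : ℝ)) k := by
    intro k
    by_cases hk : k ∈ G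
    · rw [Set.indicator_of_mem hk]
      have : cantorMeasure.real (outputClass F k (f k) ∩ D) ≤ c :=
        measureReal_mono Set.inter_subset_right
      linarith
    · rw [Set.indicator_of_notMem hk]
      have h1 : cantorMeasure.real (outputClass F k (f k)) ≤ r := not_lt.1 hk
      have : cantorMeasure.real (outputClass F k (f k) ∩ D) ≤
        cantorMeasure.real (outputClass F k (f k)) := measureReal_mono Set.inter_subset_left
      linarith
  have hlow : ∀ᶠ n in atTop, (∫ X in D, densityBelow (successSet F f X) n ∂cantorMeasure - r) /
      (c - r) ≤ densityBelow G n := by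
    filter_upwards [eventually_gt_atTop 0] with n hn
    have hn' : (0 : ℝ) < n := by exact_mod_cast hn
    rw [div_le_iff₀ (by linarith), setIntegral_densityBelow_successSet, densityBelow_eq_sum,
      sub_le_iff_le_add, div_le_iff₀ hn']
    calc _ ≤ ∑ k ∈ Finset.range n, (r + (c - r) * G.indicator (fun _ => (1 : ℝ)) k) :=
          Finset.sum_le_sum fun k _ => hq k
      _ = _ := by
          rw [Finset.sum_add_distrib, ← Finset.mul_sum]
          simp only [Finset.sum_const, Finset.card_range, nsmul_eq_mul]
          field_simp
          ring
  have hlim : Tendsto (fun n => (∫ X in D, densityBelow (successSet F f X) n ∂cantorMeasure - r) /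
      (c - r)) atTop (𝓝 1) := by
    have := ((tendsto_setIntegral_densityBelow F f).sub_const r).div_const (c - r)
    rwa [← hD, ← hc, div_self (by linarith)] at this
  exact tendsto_of_tendsto_of_tendsto_of_le_of_le' hlim tendsto_const_nhds hlow
    (Eventually.of_forall fun n => densityBelow_le_one _ _)

theorem HasDensity.mono_one {S T : Set ℕ} (hS : HasDensity S 1) (h : S ⊆ T) : HasDensity T 1 :=
  tendsto_of_tendsto_of_tendsto_of_le_of_le hS tendsto_const_nhds
    (fun n => div_le_div_of_nonneg_right (Nat.cast_le.2
      (Set.ncard_le_ncard (Set.inter_subset_inter_left _ h)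
        ((Set.finite_Iio n).subset Set.inter_subset_right))) (by positivity))
    fun n => densityBelow_le_one _ _

/-! ### Restricting a functional to a clopen class -/

/-- A string shorter than `k` is not truncated to a member of `L`, so nothing is output before `k`
bits are known; from then on the test never changes. -/
theorem IsFunctional.restrict {F : List Bool × ℕ → Option ℕ} (hF : IsFunctional F) {k : ℕ}
    {L : List (List Bool)} (hL : ∀ ρ ∈ L, ρ.length = k) :
    IsFunctional fun p => if p.1.take k ∈ L then F p else none := by
  refine ⟨Primrec.ite ?_ hF.primrec (Primrec.const none), fun {τ τ'} h n v hv => ?_⟩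
  · exact ((Primrec.eq (α := List Bool)).exists_mem_list.comp (Primrec.const L)
      (Primrec.list_take.comp (Primrec.const k) Primrec.fst)).of_eq fun p => by simp
  · simp only at hv ⊢
    split_ifs at hv with hτ
    have hlen := hL _ hτ
    rw [List.length_take] at hlen
    obtain ⟨t, rfl⟩ := h
    rw [List.take_append_of_le_length (by omega), if_pos hτ]
    exact hF.mono (List.prefix_append _ _) hv

theorem exists_restrict_eq_some {F : List Bool × ℕ → Option ℕ} (hF : IsFunctional F) {k : ℕ}
    {L : List (List Bool)} (hL : ∀ ρ ∈ L, ρ.length = k) (X : ℕ → Bool) (n v : ℕ) :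
    (∃ s, (if (initSeg X s).take k ∈ L then F (initSeg X s, n) else none) = some v) ↔
      initSeg X k ∈ L ∧ ∃ s, F (initSeg X s, n) = some v := by
  constructor
  · rintro ⟨s, hs⟩
    split_ifs at hs with h
    have hlen := hL _ h
    rw [List.length_take, length_initSeg] at hlen
    rw [take_initSeg X (by omega)] at h
    exact ⟨h, s, hs⟩
  · rintro ⟨h, s, hs⟩
    refine ⟨max k s, ?_⟩
    rw [take_initSeg X (le_max_left _ _), if_pos h]
    exact hF.mono_initSeg (le_max_right _ _) hs

/-- After restriction to `K`, the good oracles in `K` remain good and fill more than half of it,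
which is the threshold needed both for uniqueness of the winner and for averaging. -/
theorem denselyComputable_of_measure_ne_zero {F : List Bool × ℕ → Option ℕ} (hF : IsFunctional F)
    {f : ℕ → ℕ} (h : cantorMeasure {X | HasDensity (successSet F f X) 1} ≠ 0) :
    DenselyComputable f := by
  obtain ⟨k, L, hnd, hL, hlt⟩ := exists_clopen_half_lt h
  have hiff := exists_restrict_eq_some hF hL
  set K := {X | initSeg X k ∈ L} with hK
  set G : List Bool × ℕ → Option ℕ := fun p => if p.1.take k ∈ L then F p else none with hG
  have hGF : IsFunctional G := hF.restrict hL
  have hGK : ∀ n v, outputClass G n v ⊆ K := fun n v X hX => ((hiff X n v).1 hX).1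
  obtain ⟨d, hd, hdv⟩ := exists_partrec_majority hGF hGK (cantorMeasure_initSeg_mem hnd hL)
  refine ⟨d, hd, (hasDensity_majority G f (r := cantorMeasure.real K / 2) ?_).mono_one
    fun n hn => hdv n _ hn⟩
  have hsub : {X | HasDensity (successSet F f X) 1} ∩ K ⊆
      {X | HasDensity (successSet G f X) 1} := by
    rintro X ⟨hX, hXK⟩
    exact hX.mono_one fun n hn => (hiff X n (f n)).2 ⟨hXK, hn⟩
  have := measureReal_mono (μ := cantorMeasure) hsub
  linarith

/-! ### Null success classes and upper cones -/

theorem isDenseDescription_iff_of_computes {F : List Bool × ℕ → Option ℕ} {X : ℕ → Bool}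
    {d : ℕ →. ℕ} (h : FunctionalComputes F X d) (f : ℕ → ℕ) :
    IsDenseDescription d f ↔ HasDensity (successSet F f X) 1 := by
  have : {n | f n ∈ d n} = successSet F f X := Set.ext fun n => h n (f n)
  rw [IsDenseDescription, this]

/-- A functional is determined by the partial recursive function it induces on codes. -/
theorem countable_isFunctional : {F : List Bool × ℕ → Option ℕ | IsFunctional F}.Countable := by
  have h : Function.Injective fun F : {F : List Bool × ℕ → Option ℕ // IsFunctional F} =>
      (⟨_, (F.2.primrec.to_comp.partrec :
        Nat.Partrec _)⟩ : {g : ℕ →. ℕ // Nat.Partrec g}) := by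
    intro F G hFG
    refine Subtype.ext (funext fun p => ?_)
    have := congrFun (congrArg Subtype.val hFG) (Encodable.encode p)
    simpa using this
  have : Countable {g : ℕ →. ℕ // Nat.Partrec g} := by
    simp only [← Partrec.nat_iff]; infer_instance
  exact h.countable

/-- The class of oracles for which some functional computes `f` on a set of density `1`. -/
def denseSuccessClass (f : ℕ → ℕ) : Set (ℕ → Bool) :=
  {X | ∃ F, IsFunctional F ∧ HasDensity (successSet F f X) 1}

theorem cantorMeasure_denseSuccessClass {f : ℕ → ℕ} (hf : ¬ DenselyComputable f) :
    cantorMeasure (denseSuccessClass f) = 0 := by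
  have h : denseSuccessClass f = ⋃ F ∈ {F : List Bool × ℕ → Option ℕ | IsFunctional F},
      {X | HasDensity (successSet F f X) 1} := by
    ext X; simp [denseSuccessClass]
  rw [h, measure_biUnion_null_iff countable_isFunctional]
  exact fun F hF => by_contra fun h => hf (denselyComputable_of_measure_ne_zero hF h)

theorem DenselyComputableIn.mem_denseSuccessClass {X : ℕ → Bool} {f : ℕ → ℕ}
    (h : DenselyComputableIn X f) : X ∈ denseSuccessClass f := by
  obtain ⟨d, hd, hdf⟩ := h
  obtain ⟨F, hF, hFd⟩ := exists_functional_of_recursiveIn hd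
  exact ⟨F, hF, (isDenseDescription_iff_of_computes hFd f).1 hdf⟩

theorem hasDensity_univ : HasDensity Set.univ 1 := by
  refine tendsto_const_nhds.congr' ?_
  filter_upwards [eventually_gt_atTop 0] with n hn
  have hn' : (n : ℝ) ≠ 0 := by exact_mod_cast hn.ne'
  simp [densityBelow, Set.ncard_eq_toFinset_card', hn']

/-- It is enough to use one dense description of `charFn X`, namely `charFn X` itself. -/
theorem NonuniformDenseReducible.mem_denseSuccessClass {f : ℕ → ℕ} {X : ℕ → Bool}
    (h : NonuniformDenseReducible f (charFn X)) : X ∈ denseSuccessClass f := by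
  obtain ⟨e, he, hred⟩ := h (charFn X) (by simpa [IsDenseDescription] using hasDensity_univ)
  obtain ⟨F, hF, hFe⟩ := exists_functional_of_enumReducible hred
  exact ⟨F, hF, (isDenseDescription_iff_of_computes hFe f).1 he⟩

theorem UniformDenseReducible.nonuniform {f g : ℕ → ℕ} (h : UniformDenseReducible f g) :
    NonuniformDenseReducible f g := by
  obtain ⟨W, hW, h⟩ := h
  intro d hd
  obtain ⟨e, he, hWe⟩ := h d hd
  exact ⟨e, he, W, hW, hWe⟩

/-- The operator ignores its input: it enumerates the c.e. graph of `d` through axioms with empty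
premise. -/
theorem DenselyComputable.uniformDenseReducible {f : ℕ → ℕ} (hf : DenselyComputable f)
    (g : ℕ → ℕ) : UniformDenseReducible f g := by
  obtain ⟨d, hd, hdf⟩ := hf
  refine ⟨{p | p.1 = [] ∧ p.2 ∈ graphOf d}, ?_, fun _ _ => ⟨d, hdf, ?_⟩⟩
  · have hguard : Partrec fun q : (List ℕ × ℕ) × ℕ =>
        ((if q.1.1 = [] ∧ q.2 = q.1.2.unpair.2 then some () else none : Option Unit) : Part Unit) :=
      Computable.ofOption (Primrec.to_comp (Primrec.ite (PrimrecPred.and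
        (Primrec.eq.comp (Primrec.fst.comp Primrec.fst) (Primrec.const []))
        (Primrec.eq.comp Primrec.snd (Primrec.snd.comp (Primrec.unpair.comp
          (Primrec.snd.comp Primrec.fst))))) (Primrec.const (some ())) (Primrec.const none)))
    have hd' : Partrec fun p : List ℕ × ℕ => d p.2.unpair.1 :=
      (Partrec.nat_iff.2 hd).comp (Primrec.to_comp (Primrec.fst.comp (Primrec.unpair.comp
        Primrec.snd)))
    refine (hd'.bind hguard.to₂).dom_re.of_eq fun p => ?_
    rw [Part.dom_iff_mem]
    constructor
    · rintro ⟨_, h⟩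
      obtain ⟨v, hv, h⟩ := Part.mem_bind_iff.1 h
      by_cases hc : p.1 = [] ∧ v = p.2.unpair.2
      · exact ⟨hc.1, show p.2.unpair.2 ∈ d p.2.unpair.1 from hc.2 ▸ hv⟩
      · simp [hc] at h
    · rintro ⟨hnil, hp⟩
      exact ⟨(), Part.mem_bind_iff.2 ⟨p.2.unpair.2, hp, by simp [hnil]⟩⟩
  · ext k
    constructor
    · rintro ⟨F, ⟨-, hk⟩, -⟩
      exact hk
    · exact fun hk => ⟨[], ⟨rfl, hk⟩, by simp⟩

/-- Any relation between the uniform and nonuniform reducibilities is covered: the weaker one places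
the cone in the null class, the stronger one puts a densely computable `A` below every set. -/
theorem cantorMeasure_upperCone {r : (ℕ → ℕ) → (ℕ → ℕ) → Prop}
    (h₁ : ∀ f g, UniformDenseReducible f g → r f g)
    (h₂ : ∀ f g, r f g → NonuniformDenseReducible f g) {A : ℕ → Bool}
    (hA : NontrivialCone r A) : cantorMeasure (upperCone r A) = 0 := by
  obtain ⟨B, hB⟩ := hA
  refine measure_mono_null (fun X hX => (h₂ _ _ hX).mem_denseSuccessClass)
    (cantorMeasure_denseSuccessClass fun hdc => hB (h₁ _ _ (hdc.uniformDenseReducible _)))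

theorem mainTheorem1 :
    (∀ f : ℕ → ℕ, ¬ DenselyComputable f →
      cantorMeasure {X | DenselyComputableIn X f} = 0 ∧
      ∀ X : ℕ → Bool, DenselyComputableIn X f → ¬ WeaklyRandom 4 f X) ∧
    (∀ A : ℕ → Bool, NontrivialCone UniformDenseReducible A →
      cantorMeasure (upperCone UniformDenseReducible A) = 0) ∧
    (∀ A : ℕ → Bool, NontrivialCone NonuniformDenseReducible A →
      cantorMeasure (upperCone NonuniformDenseReducible A) = 0) := by
  refine ⟨fun f hf => ⟨measure_mono_null (fun X hX => hX.mem_denseSuccessClass)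
      (cantorMeasure_denseSuccessClass hf), fun X hX hrand => ?_⟩,
    fun A hA => cantorMeasure_upperCone (fun _ _ h => h) (fun _ _ h => h.nonuniform) hA,
    fun A hA => cantorMeasure_upperCone (fun _ _ h => h.nonuniform) (fun _ _ h => h) hA⟩
  obtain ⟨F, hF, hdense⟩ := hX.mem_denseSuccessClass
  have hnull : cantorMeasure {X | HasDensity (successSet F f X) 1} = 0 :=
    by_contra fun h => hf (denselyComputable_of_measure_ne_zero hF h)
  -- The complement of the success class of this one `F` has measure 1, so weak randomness would put
  -- `X` in it, against `hdense`.
  exact hrand _ (isSigmaClass_not_hasDensity hF f)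
    ((prob_compl_eq_one_iff (measurableSet_hasDensity_successSet F f 1)).2 hnull) hdense
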